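/- Let $\mathcal V$ be a finite-dimensional real inner product space and let $K\subseteq\mathcal V$ be a proper cone, i.e. a closed convex cone with $K\cap(-K)=\{0\}$ and nonempty interior; let $K^*=\{y:\langle x,y\rangle\ge 0\ \forall x\in K\}$ be its dual cone. A face of $K$ is a (nonempty) convex cone $F\subseteq K$ such that $b,c\in K$ and $b+c\in F$ imply $b,c\in F$. A linear map $L$ on $\mathcal V$ is a $Z$-transformation on $K$, written $L\in Z(K)$, if $\langle L(x),y\rangle\le 0$ whenever $x\in K$, $y\in K^*$ and $\langle x,y\rangle=0$; it is called positive, written $L\in\pi(K)$, if $L(K)\subseteq K$. A map $T\in\pi(K)$ is cone-irreducible (or $K$-irreducible) if $\{0\}$ and $K$ are the only faces $F$ of $K$ with $T(F)\subseteq F$. A linear map $L$ is space-irreducible if $\{0\}$ and $K$ are the only faces $F$ of $K$ with $L(F-F)\subseteq F-F$. Recall that $L\in Z(K)$ implies $\exp(-tL)\in\pi(K)$ for all $t\ge 0$. Let $L\in Z(K)$. If $\exp(-tL)$ is cone-irreducible for some $t>0$, then $L$ is space-irreducible. Conversely, suppose that $\mathcal V$ is a Euclidean Jordan algebra (that is,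 it carries a commutative bilinear product $\circ$ with a unit element, satisfying $x\circ(x^2\circ y)=x^2\circ(x\circ y)$ and $\langle x\circ y,z\rangle=\langle y,x\circ z\rangle$), that $K=\{x\circ x:x\in\mathcal V\}$ is its symmetric cone, and that $L=rI-S$ for some $r\in\mathbb R$ and $S\in\pi(K)$. If $L$ is space-irreducible, then $\exp(-tL)$ is cone-irreducible for some $t>0$. -/

import Mathlib

open scoped Pointwise

namespace ConeGame

variable {V : Type*} [NormedAddCommGroup V] [InnerProductSpace ℝ V]

/-- A proper cone: a closed convex cone `K` with `K ∩ -K = {0}` and with nonempty interior.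
(`PointedCone` is Mathlib's name for a convex cone that contains `0`, so it does not include the
condition `K ∩ -K = {0}`; the latter is `salient`.) -/
structure IsProperCone (K : PointedCone ℝ V) : Prop where
  isClosed : IsClosed (K : Set V)
  salient : ∀ x ∈ K, -x ∈ K → x = 0
  interior_nonempty : (interior (K : Set V)).Nonempty

/-- The dual cone `K* = {y : ⟨x, y⟩ ≥ 0 for all x ∈ K}`. -/
def dualCone (K : PointedCone ℝ V) : Set V :=
  {y | ∀ x ∈ K, 0 ≤ inner ℝ x y}

/-- `L` is a `Z`-transformation on `K`: `⟨L x, y⟩ ≤ 0` whenever `x ∈ K`, `y` is in the dual cone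
`K*` and `⟨x, y⟩ = 0`. -/
def IsZTransformation (K : PointedCone ℝ V) (L : V →L[ℝ] V) : Prop :=
  ∀ x ∈ K, ∀ y ∈ dualCone K, inner ℝ x y = 0 → inner ℝ (L x) y ≤ 0

/-- `T` is a positive transformation on `K`: `T(K) ⊆ K`. -/
def IsPositiveTransformation (K : PointedCone ℝ V) (T : V →L[ℝ] V) : Prop :=
  Set.MapsTo T (K : Set V) (K : Set V)

/-- The face condition of `K`-irreducibility (cone-irreducibility): the only faces of `K` that are
invariant under `T` are `{0}` and `K`. The notion is meant for `T` with `T(K) ⊆ K`; that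
requirement is kept separate. -/
def IsConeIrreducible (K : PointedCone ℝ V) (T : V →L[ℝ] V) : Prop :=
  ∀ F : PointedCone ℝ V, F.IsFaceOf K →
    Set.MapsTo T (F : Set V) (F : Set V) → F = ⊥ ∨ F = K

/-- `L` is space-irreducible relative to `K`: the only faces `F` of `K` with
`L(F - F) ⊆ F - F` are `{0}` and `K`. -/
def IsSpaceIrreducible (K : PointedCone ℝ V) (L : V →L[ℝ] V) : Prop :=
  ∀ F : PointedCone ℝ V, F.IsFaceOf K →
    Set.MapsTo L ((F : Set V) - (F : Set V)) ((F : Set V) - (F : Set V)) → F = ⊥ ∨ F = K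

variable (V) in
/-- A Euclidean Jordan algebra structure on the real inner product space `V` (finite dimensional
in the uses below): a commutative bilinear product with unit that satisfies the Jordan identity
`x ∘ (x² ∘ y) = x² ∘ (x ∘ y)` and for which `⟨x ∘ y, z⟩ = ⟨y, x ∘ z⟩`. -/
structure EuclideanJordanStructure where
  /-- The Jordan product `x ∘ y`. -/
  mul : V →ₗ[ℝ] V →ₗ[ℝ] V
  /-- The unit element. -/
  one : V
  mul_comm : ∀ x y, mul x y = mul y x
  one_mul : ∀ x, mul one x = x
  jordan : ∀ x y, mul x (mul (mul x x) y) = mul (mul x x) (mul x y)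
  inner_mul : ∀ x y z, inner ℝ (mul x y) z = inner ℝ y (mul x z)

/-- The symmetric cone `{x ∘ x : x ∈ V}` of a Euclidean Jordan algebra. -/
def EuclideanJordanStructure.symmetricCone (J : EuclideanJordanStructure V) : Set V :=
  {z | ∃ x, z = J.mul x x}

end ConeGame

namespace ConeGame

variable {V : Type*} [NormedAddCommGroup V] [InnerProductSpace ℝ V]

/-! A face satisfies `F = K ∩ (F - F)`. If `L` preserves `F - F`, so does `exp (-tL)`, the subspace
being closed; as `exp (-tL)` also preserves `K` (Gronwall for the squared distance to `K`), it
preserves `F`. Conversely, `exp (-(rI - S))` is `exp S` up to a positive scalar, and `exp S x` is `S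
x` plus an element of `K`. An invariant face thus contains `S x` for each of its points `x`, so `rI
- S` preserves `F - F`. -/

/-- The linear span `F - F` of a cone `F`. -/
def differenceSubmodule (F : PointedCone ℝ V) : Submodule ℝ V where
  carrier := (F : Set V) - (F : Set V)
  zero_mem' := ⟨0, F.zero_mem, 0, F.zero_mem, sub_zero 0⟩
  add_mem' := by
    rintro _ _ ⟨a, ha, b, hb, rfl⟩ ⟨c, hc, d, hd, rfl⟩
    exact ⟨a + c, F.add_mem ha hc, b + d, F.add_mem hb hd, by simp only; abel⟩
  smul_mem' := by
    rintro c _ ⟨a, ha, b, hb, rfl⟩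
    rcases le_total 0 c with hc | hc
    · exact ⟨c • a, F.smul_mem hc ha, c • b, F.smul_mem hc hb, (smul_sub c a b).symm⟩
    · refine ⟨(-c) • b, F.smul_mem (neg_nonneg.2 hc) hb,
        (-c) • a, F.smul_mem (neg_nonneg.2 hc) ha, ?_⟩
      simp only [neg_smul, smul_sub]
      abel

/-- A face of `K` is the intersection of `K` with the span of the face. -/
theorem mem_face_of_mem_sub {F K : PointedCone ℝ V} (hF : F.IsFaceOf K) {x : V} (hxK : x ∈ K)
    (hx : x ∈ (F : Set V) - (F : Set V)) : x ∈ F := by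
  obtain ⟨a, ha, b, hb, rfl⟩ := hx
  exact hF.mem_of_add_mem_left hxK (hF.le hb) (by simpa using ha)

theorem mapsTo_pow {s : Set V} {A : V →L[ℝ] V} (hA : Set.MapsTo A s s) (n : ℕ) :
    Set.MapsTo (A ^ n) s s := by
  rw [FunLike.coe_pow_eq_iterate]
  exact hA.iterate n

/-- Moreau decomposition: every point has a nearest point in a closed cone; the difference lies in
the dual cone and is orthogonal to the nearest point. -/
theorem exists_nearest_point_mem_dualCone [CompleteSpace V] (K : PointedCone ℝ V)
    (hK : IsClosed (K : Set V)) (x : V) :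
    ∃ p ∈ K, p - x ∈ dualCone K ∧ inner ℝ p (p - x) = 0 ∧
      ‖x - p‖ = Metric.infDist x (K : Set V) := by
  have hne : (K : Set V).Nonempty := ⟨0, K.zero_mem⟩
  have hconv : Convex ℝ (K : Set V) := PointedCone.convex K
  obtain ⟨p, hp, hmin⟩ := exists_norm_eq_iInf_of_complete_convex hne hK.isComplete hconv x
  have hle := (norm_eq_iInf_iff_real_inner_le_zero hconv hp).1 hmin
  -- Testing against `0` and `2p` bounds `⟨x - p, p⟩` from both sides.
  have h0 := hle 0 K.zero_mem
  have h2 := hle (p + p) (K.add_mem hp hp)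
  have horth : inner ℝ (x - p) p = 0 := by
    rw [zero_sub, inner_neg_right] at h0
    rw [add_sub_cancel_right] at h2
    linarith
  refine ⟨p, hp, fun w hw => ?_, ?_, ?_⟩
  · have h := hle w hw
    rw [inner_sub_right, horth, sub_zero] at h
    rw [real_inner_comm, ← neg_sub x p, inner_neg_left]
    linarith
  · rw [real_inner_comm, ← neg_sub x p, inner_neg_left, horth, neg_zero]
  · rw [hmin, Metric.infDist_eq_iInf]
    simp only [dist_eq_norm]

variable [FiniteDimensional ℝ V]

/-- The derivative of an orbit of the semigroup generated by `-L`. -/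
theorem hasDerivAt_exp_neg_smul_apply (L : V →L[ℝ] V) (x : V) (s : ℝ) :
    HasDerivAt (fun u : ℝ => NormedSpace.exp (-u • L) x)
      (-L (NormedSpace.exp (-s • L) x)) s := by
  have h := (hasDerivAt_exp_smul_const' (𝕂 := ℝ) (-L) s).clm_apply (hasDerivAt_const s x)
  simpa using h

/-- A `Z`-transformation on a closed cone generates a semigroup of positive transformations. -/
theorem IsZTransformation.isPositiveTransformation_exp {K : PointedCone ℝ V}
    (hK : IsClosed (K : Set V)) {L : V →L[ℝ] V} (hL : IsZTransformation K L) {t : ℝ}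
    (ht : 0 ≤ t) : IsPositiveTransformation K (NormedSpace.exp (-t • L)) := by
  intro x hx
  have hne : (K : Set V).Nonempty := ⟨0, K.zero_mem⟩
  choose p hpK hpdual hporth hpdist using exists_nearest_point_mem_dualCone K hK
  set X : ℝ → V := fun s => NormedSpace.exp (-s • L) x with hX
  have hderiv : ∀ s, HasDerivAt X (-L (X s)) s := hasDerivAt_exp_neg_smul_apply L x
  have hcont : Continuous X :=
    continuous_iff_continuousAt.2 fun s => (hderiv s).continuousAt
  set f : ℝ → ℝ := fun s => Metric.infDist (X s) (K : Set V) ^ 2 with hf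
  set f' : ℝ → ℝ := fun s => 2 * inner ℝ (X s - p (X s)) (-L (X s)) with hf'
  have hfX : ∀ s, f s = ‖X s - p (X s)‖ ^ 2 := fun s => by rw [hpdist]
  -- Freezing the nearest point at time `s` gives a smooth function that dominates `f` and touches
  -- it at `s`, so the projection need not be differentiated.
  have hdini : ∀ s ∈ Set.Ico 0 t, ∀ r, f' s < r →
      ∃ᶠ z in nhdsWithin s (Set.Ioi s), (z - s)⁻¹ * (f z - f s) < r := by
    intro s _ r hr
    have hd : HasDerivAt (fun z => ‖X z - p (X s)‖ ^ 2) (f' s) s :=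
      ((hderiv s).sub_const (p (X s))).norm_sq
    have hev := hd.hasDerivWithinAt.limsup_slope_le' (s := Set.Ioi s) (by simp) hr
    refine (hev.and self_mem_nhdsWithin).frequently.mono ?_
    rintro z ⟨hz, hsz⟩
    have hpos : 0 < z - s := sub_pos.2 hsz
    refine lt_of_le_of_lt ?_ hz
    rw [slope_def_field, div_eq_inv_mul]
    refine mul_le_mul_of_nonneg_left ?_ (inv_nonneg.2 hpos.le)
    rw [hfX s]
    refine sub_le_sub_right (pow_le_pow_left₀ Metric.infDist_nonneg ?_ 2) _
    rw [← dist_eq_norm]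
    exact Metric.infDist_le_dist_of_mem (hpK _)
  have hbound : ∀ s ∈ Set.Ico 0 t, f' s ≤ 2 * ‖L‖ * f s + 0 := by
    intro s _
    set y := p (X s) - X s with hy
    have hXy : X s = p (X s) - y := by rw [hy]; abel
    -- The Z-condition discards the only term of `f'` not quadratic in the distance.
    have hz : inner ℝ (L (p (X s))) y ≤ 0 := hL _ (hpK _) _ (hpdual _) (hporth _)
    have hnorm : -inner ℝ (L y) y ≤ ‖L‖ * ‖y‖ ^ 2 := by
      refine (neg_le_abs _).trans ((abs_real_inner_le_norm _ _).trans ?_)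
      rw [pow_two, ← mul_assoc]
      exact mul_le_mul_of_nonneg_right (L.le_opNorm y) (norm_nonneg y)
    have hf'y : f' s = 2 * (inner ℝ (L (p (X s))) y - inner ℝ (L y) y) := by
      have h1 : X s - p (X s) = -y := by rw [hy]; abel
      have h2 : L (X s) = L (p (X s)) - L y := by rw [← map_sub, ← hXy]
      simp only [hf']
      rw [h1, h2, inner_neg_neg, real_inner_comm, inner_sub_left]
    have hfy : f s = ‖y‖ ^ 2 := by rw [hfX, norm_sub_rev]
    rw [hf'y, hfy]
    linarith
  have hf0 : f 0 ≤ 0 := by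
    have hX0 : X 0 = x := by simp [hX]
    simp only [hf, hX0]
    rw [Metric.infDist_zero_of_mem hx]
    simp
  have hfcont : Continuous f := ((Metric.continuous_infDist_pt _).comp hcont).pow 2
  have hmain := le_gronwallBound_of_liminf_deriv_right_le hfcont.continuousOn hdini hf0 hbound t
    ⟨ht, le_rfl⟩
  rw [gronwallBound_ε0_δ0] at hmain
  have hzero : Metric.infDist (X t) (K : Set V) = 0 :=
    pow_eq_zero_iff two_ne_zero |>.1 (le_antisymm hmain (sq_nonneg _))
  exact (hK.mem_iff_infDist_zero hne).2 hzero

/-- The exponential series applied to a vector. -/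
theorem hasSum_exp_apply (A : V →L[ℝ] V) (x : V) :
    HasSum (fun n : ℕ => ((n.factorial : ℝ)⁻¹) • (A ^ n) x) (NormedSpace.exp A x) := by
  have h := NormedSpace.exp_series_hasSum_exp' (𝕂 := ℝ) A
  simpa using h.mapL (ContinuousLinearMap.apply ℝ V x)

/-- A subspace invariant under `A` is invariant under `exp A`. -/
theorem mapsTo_exp_of_mapsTo_submodule {W : Submodule ℝ V} {A : V →L[ℝ] V}
    (hA : Set.MapsTo A (W : Set V) (W : Set V)) :
    Set.MapsTo (NormedSpace.exp A : V →L[ℝ] V) (W : Set V) (W : Set V) := fun x hx =>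
  W.closed_of_finiteDimensional.mem_of_tendsto (hasSum_exp_apply A x)
    (Filter.Eventually.of_forall fun _ =>
      W.sum_mem fun n _ => W.smul_mem _ (mapsTo_pow hA n hx))

/-- For a positive transformation `S` of a closed cone, `exp S x - (x + S x)` lies in the cone. -/
theorem IsPositiveTransformation.exp_sub_mem {K : PointedCone ℝ V} (hK : IsClosed (K : Set V))
    {S : V →L[ℝ] V} (hS : IsPositiveTransformation K S) {x : V} (hx : x ∈ K) :
    NormedSpace.exp S x - (x + S x) ∈ K := by
  -- Removing the first two terms leaves a series of nonnegative multiples of `S ^ n x`, `n ≥ 2`.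
  have h := (hasSum_nat_add_iff' 2).2 (hasSum_exp_apply S x)
  simp only [Finset.sum_range_succ, Finset.sum_range_zero, zero_add, Nat.factorial_zero,
    Nat.factorial_one, Nat.cast_one, inv_one, one_smul, pow_zero, pow_one,
    one_apply_eq_self] at h
  refine hK.mem_of_tendsto h (Filter.Eventually.of_forall fun _ => K.sum_mem fun n _ => ?_)
  exact K.smul_mem (by positivity) (mapsTo_pow hS (n + 2) hx)

/-- A face invariant under `exp S`, with `S` positive, is invariant under `S`. -/
theorem IsPositiveTransformation.mapsTo_face_of_mapsTo_exp {K F : PointedCone ℝ V}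
    (hK : IsClosed (K : Set V)) {S : V →L[ℝ] V} (hS : IsPositiveTransformation K S)
    (hF : F.IsFaceOf K)
    (hexp : Set.MapsTo (NormedSpace.exp S : V →L[ℝ] V) (F : Set V) (F : Set V)) :
    Set.MapsTo S (F : Set V) (F : Set V) := by
  intro x hx
  have hxK := hF.le hx
  have hsum : S x + (x + (NormedSpace.exp S x - (x + S x))) ∈ F := by
    have h : S x + (x + (NormedSpace.exp S x - (x + S x))) = NormedSpace.exp S x := by abel
    rw [h]
    exact hexp hx
  exact hF.mem_of_add_mem_left (hS hxK) (K.add_mem hxK (hS.exp_sub_mem hK hxK)) hsum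

/-- Adding a multiple of the identity to `A` scales `exp A`. -/
theorem exp_smul_id_add (c : ℝ) (A : V →L[ℝ] V) :
    NormedSpace.exp (c • ContinuousLinearMap.id ℝ V + A) = Real.exp c • NormedSpace.exp A := by
  let : NormedAlgebra ℚ (V →L[ℝ] V) := NormedAlgebra.restrictScalars ℚ ℝ (V →L[ℝ] V)
  have hid : c • ContinuousLinearMap.id ℝ V = algebraMap ℝ (V →L[ℝ] V) c :=
    (Algebra.algebraMap_eq_smul_one c).symm
  rw [hid, NormedSpace.exp_add_of_commute (Algebra.commutes c A),
    ← NormedSpace.algebraMap_exp_comm, ← Real.exp_eq_exp_ℝ, ← Algebra.smul_def]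

variable {K : PointedCone ℝ V} {L : V →L[ℝ] V}

/-- The orbit of a point of `F` stays in `F - F` by invariance and in `K` by positivity, hence in
`F`. -/
theorem IsZTransformation.isSpaceIrreducible_of_isConeIrreducible_exp
    (hK : IsClosed (K : Set V)) (hL : IsZTransformation K L) {t : ℝ} (ht : 0 ≤ t)
    (h : IsConeIrreducible K (NormedSpace.exp (-t • L))) : IsSpaceIrreducible K L := by
  intro F hF hinv
  have hinv' : Set.MapsTo (-t • L) (differenceSubmodule F : Set V) (differenceSubmodule F) :=
    fun x hx => (differenceSubmodule F).smul_mem (-t) (hinv hx)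
  refine h F hF fun x hx => mem_face_of_mem_sub hF
    (hL.isPositiveTransformation_exp hK ht (hF.le hx)) ?_
  exact mapsTo_exp_of_mapsTo_submodule hinv' ⟨x, hx, 0, F.zero_mem, sub_zero x⟩

/-- If `r I - S` is space-irreducible for a positive `S`, then `exp (-(r I - S))` is
cone-irreducible. -/
theorem IsPositiveTransformation.isConeIrreducible_exp_of_isSpaceIrreducible
    (hK : IsClosed (K : Set V)) {S : V →L[ℝ] V} (hS : IsPositiveTransformation K S) {r : ℝ}
    (h : IsSpaceIrreducible K (r • ContinuousLinearMap.id ℝ V - S)) :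
    IsConeIrreducible K
      (NormedSpace.exp (-(1 : ℝ) • (r • ContinuousLinearMap.id ℝ V - S))) := by
  intro F hF hinv
  have hL : -(1 : ℝ) • (r • ContinuousLinearMap.id ℝ V - S) =
      (-r) • ContinuousLinearMap.id ℝ V + S := by
    rw [neg_smul, one_smul, neg_smul]
    abel
  rw [hL, exp_smul_id_add] at hinv
  have hexp : Set.MapsTo (NormedSpace.exp S : V →L[ℝ] V) (F : Set V) (F : Set V) := by
    intro x hx
    have hmem := F.smul_mem (Real.exp_pos r).le (hinv hx)
    have heq : Real.exp r • Real.exp (-r) • (NormedSpace.exp S x) = NormedSpace.exp S x := by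
      rw [smul_smul, ← Real.exp_add, add_neg_cancel, Real.exp_zero, one_smul]
    rw [← heq]
    exact hmem
  have hSF := hS.mapsTo_face_of_mapsTo_exp hK hF hexp
  have hSspan : Set.MapsTo S (differenceSubmodule F : Set V) (differenceSubmodule F) := by
    rintro _ ⟨a, ha, b, hb, rfl⟩
    exact ⟨S a, hSF ha, S b, hSF hb, (map_sub S a b).symm⟩
  exact h F hF fun x hx => (differenceSubmodule F).sub_mem
    ((differenceSubmodule F).smul_mem r hx) (hSspan hx)

end ConeGame

theorem mainTheorem11 {V : Type*} [NormedAddCommGroup V] [InnerProductSpace ℝ V]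
    [FiniteDimensional ℝ V]
    (K : PointedCone ℝ V) (hK : ConeGame.IsProperCone K)
    (L : V →L[ℝ] V) (hL : ConeGame.IsZTransformation K L) :
    ((∃ t : ℝ, 0 < t ∧ ConeGame.IsConeIrreducible K (NormedSpace.exp (-t • L))) →
      ConeGame.IsSpaceIrreducible K L) ∧
    (∀ J : ConeGame.EuclideanJordanStructure V, (K : Set V) = J.symmetricCone →
      ∀ (r : ℝ) (S : V →L[ℝ] V), ConeGame.IsPositiveTransformation K S →
        L = r • ContinuousLinearMap.id ℝ V - S →
        ConeGame.IsSpaceIrreducible K L →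
          ∃ t : ℝ, 0 < t ∧
            ConeGame.IsPositiveTransformation K (NormedSpace.exp (-t • L)) ∧
            ConeGame.IsConeIrreducible K (NormedSpace.exp (-t • L))) := by
  refine ⟨fun ⟨t, ht, h⟩ =>
    hL.isSpaceIrreducible_of_isConeIrreducible_exp hK.isClosed ht.le h, ?_⟩
  intro _ _ r S hS hLS hirr
  -- Any `t > 0` would do, since `t • S` is again positive; `1` avoids rescaling.
  refine ⟨1, one_pos, hL.isPositiveTransformation_exp hK.isClosed zero_le_one, ?_⟩
  subst hLS
  exact hS.isConeIrreducible_exp_of_isSpaceIrreducible hK.isClosed hirr
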